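/- Let $n\in\mathbb N$ and let $A$ be a real symmetric $n\times n$ matrix that is acyclic, i.e. the graph on $\{1,\dots,n\}$ in which $p\ne q$ are adjacent iff $A_{pq}\neq 0$ is a forest (the diagonal entries are arbitrary). For a square matrix $B$ write $\phi(B,x)=\det(xI-B)$, with $\phi=1$ for the empty matrix, and for a set $S$ of indices of $B$ write $B-S$ for the matrix obtained from $B$ by removing the rows and columns with index in $S$. Let $\lambda$ be an eigenvalue of $A$ of multiplicity $k$, and let $U=\{u_1,\dots,u_k\}$ be a $\lambda$-star set of $A$, i.e. a set of exactly $k$ indices such that $\lambda$ is not an eigenvalue of $A-U$. For $1\le i\le k$ let $U_i=U\setminus\{u_i\}$ and let $A_i$ be the component of $A-U_i$ that contains $u_i$, i.e. the principal submatrix of $A$ on the vertex set of the connected component of $u_i$ in the graph of $A-U_i$. For an index $v$ of $A_i$ let $P_{u_i,v}$ be the unique path from $u_i$ to $v$ in the graph of $A_i$, and let $W(P_{u_i,v})=\prod_{pq\in E(P_{u_i,v})}A_{pq}$ be its weight ($W=1$ if the path is a single vertex); in $A_i-P_{u_i,v}$ all the vertices of the path, including both ends, are removed. Define $\boldsymbol\alpha_i\in\mathbb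 R^n$ by $$\boldsymbol\alpha_i(v)=\begin{cases}W(P_{u_i,v})\,\phi(A_i-P_{u_i,v},\lambda) & \text{if } v \text{ is an index of } A_i,\\ 0 & \text{otherwise.}\end{cases}$$ Then each $\boldsymbol\alpha_i$ is a $\lambda$-eigenvector of $A$ (in particular nonzero), and $\boldsymbol\alpha_1,\dots,\boldsymbol\alpha_k$ are linearly independent. -/

import Mathlib

namespace AcyclicMatrix

/-- The graph associated to a symmetric matrix `A`: distinct indices `i`, `j` are adjacent
iff the entry `A i j` is nonzero (this entry is then the weight of the edge `ij`, and the diagonal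
entries are the weights of the vertices). -/
def graph {V : Type*} (A : Matrix V V ℝ) : SimpleGraph V :=
  SimpleGraph.fromRel fun i j => A i j ≠ 0

/-- `A` is an acyclic symmetric matrix: it is symmetric and it is the adjacency matrix of a
weighted forest, with nonzero weights on the edges and arbitrary weights on the vertices. -/
def IsAcyclicSymm {V : Type*} (A : Matrix V V ℝ) : Prop :=
  A.IsSymm ∧ (graph A).IsAcyclic

/-- The principal submatrix of `A` with rows and columns in `S`. -/
def principal {V : Type*} (A : Matrix V V ℝ) (S : Set V) : Matrix S S ℝ :=
  A.submatrix Subtype.val Subtype.val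

/-- `A - U`: remove the rows and columns of `A` with index in `U`. -/
def delete {V : Type*} (A : Matrix V V ℝ) (U : Set V) : Matrix (Uᶜ : Set V) (Uᶜ : Set V) ℝ :=
  principal A Uᶜ

/-- The value `φ(A, x) = |x I - A|` of the characteristic polynomial (`1` for the empty matrix). -/
noncomputable def phi {V : Type*} [Fintype V] [DecidableEq V] (A : Matrix V V ℝ) (x : ℝ) : ℝ :=
  (x • (1 : Matrix V V ℝ) - A).det

/-- The real number `x` is an eigenvalue of `A`. -/
def IsEigenvalue {V : Type*} [Fintype V] [DecidableEq V] (A : Matrix V V ℝ) (x : ℝ) : Prop :=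
  Module.End.HasEigenvalue (Matrix.toLin' A) x

/-- The vector `a` is an `x`-eigenvector of `A` (in particular `a ≠ 0`). -/
def IsEigenvector {V : Type*} [Fintype V] [DecidableEq V] (A : Matrix V V ℝ) (x : ℝ)
    (a : V → ℝ) : Prop :=
  Module.End.HasEigenvector (Matrix.toLin' A) x a

/-- The multiplicity of `x` as an eigenvalue of `A`, i.e. the dimension of the eigenspace. -/
noncomputable def multiplicity {V : Type*} [Fintype V] [DecidableEq V] (A : Matrix V V ℝ)
    (x : ℝ) : ℕ :=
  Module.finrank ℝ (Module.End.eigenspace (Matrix.toLin' A) x)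

open Classical in
/-- `U` is an `x`-star set of `A`: its size is the multiplicity of `x`, and `x` is not an
eigenvalue of `A - U`. -/
def IsStarSet {V : Type*} [Fintype V] [DecidableEq V] (A : Matrix V V ℝ) (x : ℝ)
    (U : Finset V) : Prop :=
  U.card = multiplicity A x ∧ ¬ IsEigenvalue (delete A (U : Set V)) x

/-- The weight of a path: the product of the weights of its edges (`1` for a single vertex). -/
def pathWeight {V : Type*} (A : Matrix V V ℝ) {u v : V} (P : (graph A).Path u v) : ℝ :=
  ((P : (graph A).Walk u v).darts.map fun d => A d.fst d.snd).prod

open Classical in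
/-- `W(P_{u,v}) φ(B - P_{u,v}, x)` if there is a path from `u` to `v` in the graph of `B`, and `0`
otherwise. If `B` is acyclic, then the path is unique. -/
noncomputable def pathVector {V : Type*} [Fintype V] (B : Matrix V V ℝ) (x : ℝ) (u v : V) : ℝ :=
  if h : Nonempty ((graph B).Path u v) then
    let P : (graph B).Path u v := h.some
    pathWeight B P * phi (delete B {w | w ∈ (P : (graph B).Walk u v).support}) x
  else 0

/-- The set of indices of the component of `A - U` that contains `u`. -/
def componentSet {V : Type*} (A : Matrix V V ℝ) (U : Set V) (u : V) : Set V :=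
  {v | ∃ (hu : u ∈ Uᶜ) (hv : v ∈ Uᶜ), (graph (delete A U)).Reachable ⟨u, hu⟩ ⟨v, hv⟩}

theorem mem_componentSet_self {V : Type*} {A : Matrix V V ℝ} {U : Set V} {u v : V}
    (h : v ∈ componentSet A U u) : u ∈ componentSet A U u :=
  ⟨h.1, h.1, SimpleGraph.Reachable.refl _⟩

/-- The component of `A - U` that contains `u`, as a matrix. -/
def component {V : Type*} (A : Matrix V V ℝ) (U : Set V) (u : V) :
    Matrix (componentSet A U u) (componentSet A U u) ℝ :=
  principal A (componentSet A U u)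

open Classical in
/-- With `C` the component of `A - U` that contains `u`: the vector whose entry at `v` is
`W(P_{u,v}) φ(C - P_{u,v}, x)`, the path being taken in `C`, if `v` is in `C`, and `0` otherwise. -/
noncomputable def componentVector {V : Type*} [Fintype V] (A : Matrix V V ℝ) (x : ℝ)
    (U : Set V) (u : V) : V → ℝ := fun v =>
  if h : v ∈ componentSet A U u then
    pathVector (component A U u) x ⟨u, mem_componentSet_self h⟩ ⟨v, h⟩
  else 0

end AcyclicMatrix

/-! In a forest, row `u` of the adjugate of `x I - B` is the path vector of `u`: expanding along the
rows met by a walk, only the unique path survives (`pathVector_eq_adjugate`). Let `C` be the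
component of `u` after deleting the rest of the star set `U`. Some eigenvector `a` of `A` vanishes
on `U \ {u}`; restricted to `C` it shows `x I - C` to be singular, so the adjugate row, a column by
symmetry, is a null vector. Extended by zero it satisfies the eigenvalue equation off `U`, and
`eq_zero_of_isStarSet` makes it a multiple of `a`. Each vector is nonzero at its own star vertex and
zero at the others, whence independence. -/

namespace AcyclicMatrix

open scoped Matrix

/-! ### Adjugates of matrices with some rows made identity rows. -/

section Adjugate

variable {V R : Type*} [DecidableEq V] [CommRing R]

/-- The matrix obtained from `M` by replacing the rows in `S` by those of the identity matrix. -/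
def identityRows (M : Matrix V V R) (S : Finset V) : Matrix V V R :=
  Matrix.of fun i j => if i ∈ S then (1 : Matrix V V R) i j else M i j

theorem identityRows_empty (M : Matrix V V R) : identityRows M ∅ = M := by
  ext i j
  simp [identityRows]

theorem updateRow_identityRows (M : Matrix V V R) (S : Finset V) (u : V) :
    (identityRows M S).updateRow u (Pi.single u 1) = identityRows M (insert u S) := by
  ext i j
  by_cases hi : i = u
  · subst hi
    simp [identityRows, Matrix.one_apply, Pi.single_apply, eq_comm]
  · simp [identityRows, Matrix.updateRow_apply, hi]

variable [Fintype V]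

/-- Expansion of an off-diagonal entry of the adjugate along a row. -/
theorem adjugate_eq_neg_sum_updateRow (M : Matrix V V R) {u v : V} (huv : u ≠ v) :
    M.adjugate u v =
      -∑ w, M u w * (M.updateRow u (Pi.single u 1)).adjugate w v := by
  have hexp : ∑ w, M u w * (M.updateRow u (Pi.single u 1)).adjugate w v =
      ((M.updateRow u (Pi.single u 1)).updateRow v (M u)).det := by
    have h := Matrix.cramer_transpose_apply (M.updateRow u (Pi.single u 1)) (M u) v
    rw [← h, Matrix.cramer_eq_adjugate_mulVec, ← Matrix.adjugate_transpose]
    simp [Matrix.mulVec, dotProduct, mul_comm]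
  -- Swapping rows `u` and `v` relates the two determinants; the swap is the source of the minus
  -- sign.
  have hswap := Matrix.det_permute (Equiv.swap u v) (M.updateRow v (Pi.single u 1))
  have hrows : (M.updateRow v (Pi.single u 1)).submatrix (Equiv.swap u v) id =
      (M.updateRow u (Pi.single u 1)).updateRow v (M u) := by
    ext i j
    by_cases hi : i = u
    · subst hi
      simp [Matrix.updateRow_apply, huv]
    · by_cases hi' : i = v
      · subst hi'
        simp [Matrix.updateRow_apply, huv]
      · simp [Matrix.updateRow_apply, hi, hi', Equiv.swap_apply_of_ne_of_ne hi hi']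
  rw [hexp, ← hrows, hswap, Equiv.Perm.sign_swap huv, Matrix.adjugate_apply]
  simp

theorem adjugate_identityRows_self (M : Matrix V V R) (S : Finset V) (u : V) :
    (identityRows M S).adjugate u u = (identityRows M (insert u S)).det := by
  rw [Matrix.adjugate_apply, updateRow_identityRows]

theorem adjugate_identityRows_of_mem (M : Matrix V V R) {S : Finset V} {u v : V} (hu : u ∈ S)
    (huv : u ≠ v) : (identityRows M S).adjugate u v = 0 := by
  rw [Matrix.adjugate_apply]
  refine Matrix.det_zero_of_row_eq huv ?_
  ext j
  simp [identityRows, Matrix.updateRow_apply, huv, hu, Matrix.one_apply, Pi.single_apply, eq_comm]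

theorem adjugate_identityRows_of_ne (M : Matrix V V R) {S : Finset V} {u v : V} (hu : u ∉ S)
    (huv : u ≠ v) : (identityRows M S).adjugate u v =
      -∑ w, M u w * (identityRows M (insert u S)).adjugate w v := by
  rw [adjugate_eq_neg_sum_updateRow _ huv, updateRow_identityRows]
  simp [identityRows, hu]

/-- Identity rows act as vertex deletion while the index type stays fixed, which allows induction on
`S`. The matrix is block triangular with an identity block on `S`. -/
theorem det_identityRows (M : Matrix V V R) (S : Finset V) :
    (identityRows M S).det =
      (M.submatrix (Subtype.val : {i // i ∉ S} → V) (Subtype.val : {i // i ∉ S} → V)).det := by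
  rw [Matrix.twoBlockTriangular_det (identityRows M S) (fun i => i ∉ S)]
  · have h1 : (identityRows M S).toSquareBlockProp (fun i => i ∉ S) =
        M.submatrix Subtype.val Subtype.val := by
      ext i j
      simp [identityRows, Matrix.toSquareBlockProp, i.2]
    have h2 : (identityRows M S).toSquareBlockProp (fun i => ¬ i ∉ S) = 1 := by
      ext i j
      have hi : (i : V) ∈ S := not_not.1 i.2
      simp [identityRows, Matrix.toSquareBlockProp, hi, Matrix.one_apply, Subtype.ext_iff]
    rw [h1, h2, Matrix.det_one, mul_one]
  · intro i hi j hj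
    have hi : i ∈ S := not_not.1 hi
    have hij : i ≠ j := fun h => hj (h ▸ hi)
    simp [identityRows, hi, hij]

end Adjugate

/-! ### Adjugate entries as weighted paths in a forest. -/

section Forest

variable {V : Type*}

theorem graph_adj_iff {B : Matrix V V ℝ} (hB : B.IsSymm) {i j : V} :
    (graph B).Adj i j ↔ i ≠ j ∧ B i j ≠ 0 := by
  simp [graph, SimpleGraph.fromRel_adj, hB.apply i j]

theorem isAcyclicSymm_principal {A : Matrix V V ℝ} (hA : IsAcyclicSymm A) (S : Set V) :
    IsAcyclicSymm (principal A S) := by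
  have hsymm : (principal A S).IsSymm := hA.1.submatrix _
  refine ⟨hsymm, hA.2.comap ⟨Subtype.val, ?_⟩ Subtype.val_injective⟩
  intro a b hab
  rw [graph_adj_iff hsymm] at hab
  exact (graph_adj_iff hA.1).2 ⟨fun h => hab.1 (Subtype.ext h), hab.2⟩

variable [Fintype V] [DecidableEq V]

/-- A nonzero term of the row expansion supplies the next vertex. Each vertex used joins `S`, so it
is never revisited and the recursion ends. -/
theorem exists_isPath_of_adjugate_ne_zero {B : Matrix V V ℝ} (hB : B.IsSymm) (x : ℝ) {v : V}
    {S : Finset V} (hv : v ∉ S) {u : V}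
    (h : (identityRows (x • (1 : Matrix V V ℝ) - B) S).adjugate u v ≠ 0) :
    ∃ p : (graph B).Walk u v, p.IsPath ∧ ∀ w ∈ p.support, w ∉ S := by
  induction hn : Sᶜ.card using Nat.strong_induction_on generalizing S u with
  | _ n ih =>
    by_cases huv : u = v
    · subst huv
      exact ⟨.nil, .nil, by simpa using hv⟩
    have hu : u ∉ S := fun hu => h (adjugate_identityRows_of_mem _ hu huv)
    rw [adjugate_identityRows_of_ne _ hu huv, neg_ne_zero] at h
    obtain ⟨w, -, hw⟩ := Finset.exists_ne_zero_of_sum_ne_zero h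
    have hlt : (insert u S)ᶜ.card < n := by
      rw [← hn]
      refine Finset.card_lt_card (Finset.compl_ssubset_compl.2 (Finset.ssubset_insert hu))
    obtain ⟨p, hp, hpS⟩ := ih _ hlt (S := insert u S)
      (by simp [hv, Ne.symm huv]) (right_ne_zero_of_mul hw) rfl
    have huw : u ≠ w := by
      rintro rfl
      exact hpS u p.start_mem_support (Finset.mem_insert_self _ _)
    have hadj : (graph B).Adj u w := by
      refine (graph_adj_iff hB).2 ⟨huw, ?_⟩
      simpa [huw] using left_ne_zero_of_mul hw
    refine ⟨.cons hadj p, ?_, ?_⟩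
    · rw [SimpleGraph.Walk.cons_isPath_iff]
      exact ⟨hp, fun hup => hpS u hup (Finset.mem_insert_self _ _)⟩
    · intro z hz
      rw [SimpleGraph.Walk.support_cons, List.mem_cons] at hz
      rcases hz with rfl | hz
      · exact hu
      · exact fun hzS => hpS z hz (Finset.mem_insert_of_mem hzS)

/-- Each expansion step keeps only the next vertex of the path; its sign cancels against the
off-diagonal entry `-B u w`. -/
theorem adjugate_identityRows_eq_of_isPath {B : Matrix V V ℝ} (hB : IsAcyclicSymm B) (x : ℝ)
    {u v : V} (p : (graph B).Walk u v) (hp : p.IsPath) {S : Finset V}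
    (hS : ∀ w ∈ p.support, w ∉ S) :
    (identityRows (x • (1 : Matrix V V ℝ) - B) S).adjugate u v =
      (p.darts.map fun d => B d.fst d.snd).prod *
        (identityRows (x • (1 : Matrix V V ℝ) - B) (S ∪ p.support.toFinset)).det := by
  induction p generalizing S with
  | nil =>
    rw [adjugate_identityRows_self, Finset.insert_eq, Finset.union_comm]
    simp
  | @cons u w v hadj p ih =>
    have hpath := hp
    rw [SimpleGraph.Walk.cons_isPath_iff] at hp
    have huv : u ≠ v := fun h => hp.2 (h ▸ p.end_mem_support)
    have hu : u ∉ S := hS u (by simp)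
    have hvS : v ∉ insert u S := by
      simpa [Ne.symm huv] using hS v (by simp)
    rw [adjugate_identityRows_of_ne _ hu huv, Finset.sum_eq_single w, ih hp.1]
    · have hset : insert u S ∪ p.support.toFinset =
          S ∪ (SimpleGraph.Walk.cons hadj p).support.toFinset := by
        ext z
        simp only [SimpleGraph.Walk.support_cons, List.toFinset_cons, Finset.mem_union,
          Finset.mem_insert]
        tauto
      rw [hset]
      simp [hadj.ne, mul_assoc]
    · intro z hz hzS
      rcases Finset.mem_insert.1 hzS with rfl | hzS
      · exact hp.2 hz
      · exact hS z (by simp [hz]) hzS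
    -- A nonzero term at `z ≠ w` would start a second path from `u` to `v`.
    · intro z _ hzw
      by_contra hne
      obtain ⟨q, hq, hqS⟩ :=
        exists_isPath_of_adjugate_ne_zero hB.1 x hvS (right_ne_zero_of_mul hne)
      have huq : u ∉ q.support := fun h => hqS u h (Finset.mem_insert_self _ _)
      have huz : u ≠ z := fun h => huq (h ▸ q.start_mem_support)
      have hadj' : (graph B).Adj u z := by
        refine (graph_adj_iff hB.1).2 ⟨huz, ?_⟩
        simpa [huz] using left_ne_zero_of_mul hne
      have hpath' : (SimpleGraph.Walk.cons hadj' q).IsPath :=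
        (SimpleGraph.Walk.cons_isPath_iff _ _).2 ⟨hq, huq⟩
      have heq := congrArg Subtype.val ((hB.2.subsingleton_path _ _).elim
        ⟨SimpleGraph.Walk.cons hadj' q, hpath'⟩ ⟨SimpleGraph.Walk.cons hadj p, hpath⟩)
      exact hzw (by simpa using congrArg (fun r => r.snd) heq)
    · simp

theorem phi_delete_eq_det_identityRows (B : Matrix V V ℝ) (x : ℝ) (S : Finset V) (T : Set V)
    (hT : ∀ w, w ∈ T ↔ w ∈ S) [Fintype (Tᶜ : Set V)] [DecidableEq (Tᶜ : Set V)] :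
    phi (delete B T) x = (identityRows (x • (1 : Matrix V V ℝ) - B) S).det := by
  rw [det_identityRows, phi]
  let e : (Tᶜ : Set V) ≃ {i // i ∉ S} := Equiv.subtypeEquivRight fun w => not_congr (hT w)
  rw [← Matrix.det_submatrix_equiv_self e]
  congr 1
  ext i j
  simp [delete, principal, e, Matrix.one_apply, Subtype.ext_iff]

/-- In a forest, the path vector is a row of the adjugate of `x I - B`. -/
theorem pathVector_eq_adjugate {B : Matrix V V ℝ} (hB : IsAcyclicSymm B) (x : ℝ) (u v : V) :
    pathVector B x u v = (x • (1 : Matrix V V ℝ) - B).adjugate u v := by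
  rw [pathVector, ← identityRows_empty (x • (1 : Matrix V V ℝ) - B)]
  split_ifs with h
  · rw [adjugate_identityRows_eq_of_isPath hB x _ h.some.2 (by simp)]
    have hphi := phi_delete_eq_det_identityRows B x
      (∅ ∪ (h.some : (graph B).Walk u v).support.toFinset)
      {w | w ∈ (h.some : (graph B).Walk u v).support} (by simp)
    refine congrArg₂ (· * ·) rfl (Eq.trans ?_ hphi)
    congr!
  · by_contra hne
    obtain ⟨p, hp, -⟩ :=
      exists_isPath_of_adjugate_ne_zero hB.1 x (Finset.notMem_empty v) (Ne.symm hne)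
    exact h ⟨⟨p, hp⟩⟩

end Forest

/-! ### Star sets and component vectors. -/

section StarSet

variable {V : Type*}

theorem mem_componentSet_of_adj {A : Matrix V V ℝ} {T : Set V} {u r w : V}
    (hr : r ∈ componentSet A T u) (hw : w ∉ T) (h : A r w ≠ 0) : w ∈ componentSet A T u := by
  obtain ⟨hu, hrT, hreach⟩ := hr
  by_cases hrw : r = w
  · exact hrw ▸ ⟨hu, hrT, hreach⟩
  refine ⟨hu, hw, hreach.trans (SimpleGraph.Adj.reachable ?_)⟩
  rw [graph, SimpleGraph.fromRel_adj]
  exact ⟨fun h => hrw (congrArg Subtype.val h), Or.inl h⟩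

variable [Fintype V]

theorem sum_subtype_eq_sum {S : Set V} [Fintype S] {f : V → ℝ} (hf : ∀ w ∉ S, f w = 0) :
    ∑ w : S, f w = ∑ w, f w := by
  classical
  rw [← Finset.sum_subtype (Finset.univ.filter (· ∈ S)) (by simp) f]
  refine Finset.sum_subset (Finset.subset_univ _) fun w _ hw => hf w (by simpa using hw)

theorem componentVector_of_notMem {A : Matrix V V ℝ} {x : ℝ} {T : Set V} {u v : V}
    (h : v ∉ componentSet A T u) : componentVector A x T u v = 0 := by
  rw [componentVector, dif_neg h]

/-- On a vector vanishing on `T`, the component acts as the whole matrix. -/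
theorem sum_component {A : Matrix V V ℝ} {T : Set V} {u : V} [Fintype (componentSet A T u)]
    {y : V → ℝ} (hy : ∀ w ∈ T, y w = 0) (r : componentSet A T u) :
    ∑ w : componentSet A T u, component A T u r w * y w = ∑ w, A r w * y w := by
  refine sum_subtype_eq_sum (f := fun w => A r w * y w) fun w hw => ?_
  by_cases hwT : w ∈ T
  · rw [hy w hwT, mul_zero]
  · rw [by_contra fun hne => hw (mem_componentSet_of_adj r.2 hwT hne), zero_mul]

theorem sum_eq_zero_of_notMem_componentSet {A : Matrix V V ℝ} (hA : A.IsSymm) {T : Set V}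
    {u r : V} {y : V → ℝ} (hy : ∀ w ∉ componentSet A T u, y w = 0) (hrT : r ∉ T)
    (hr : r ∉ componentSet A T u) : ∑ w, A r w * y w = 0 := by
  refine Finset.sum_eq_zero fun w _ => ?_
  by_cases hw : w ∈ componentSet A T u
  · have h : A w r = 0 := by_contra fun hne => hr (mem_componentSet_of_adj hw hrT hne)
    rw [← hA.apply r w, h, zero_mul]
  · rw [hy w hw, mul_zero]

variable [DecidableEq V]

/-- A vector that vanishes on a star set and satisfies the eigenvalue equation off the star set
is zero. -/
theorem eq_zero_of_isStarSet {A : Matrix V V ℝ} {x : ℝ} {U : Finset V} (hU : IsStarSet A x U)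
    {y : V → ℝ} (hy : ∀ w ∈ U, y w = 0) (hAy : ∀ r ∉ U, ∑ w, A r w * y w = x * y r) : y = 0 := by
  classical
  by_contra hne
  refine hU.2 (Module.End.hasEigenvalue_of_hasEigenvector
    (x := fun w : ((U : Set V)ᶜ : Set V) => y w) ⟨?_, ?_⟩)
  · rw [Module.End.mem_eigenspace_iff]
    funext r
    rw [Matrix.toLin'_apply]
    have h := sum_subtype_eq_sum (S := (U : Set V)ᶜ) (f := fun w => A r w * y w)
      (fun w hw => by simp [hy w (by simpa using hw)])
    simp only [Matrix.mulVec, dotProduct, delete, principal, Matrix.submatrix_apply,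
      Pi.smul_apply, smul_eq_mul]
    rw [← hAy r r.2, ← h]
  · intro h0
    refine hne (funext fun w => ?_)
    by_cases hw : w ∈ U
    · exact hy w hw
    · exact congrFun h0 ⟨w, by simpa using hw⟩

theorem isEigenvector_iff {A : Matrix V V ℝ} {x : ℝ} {a : V → ℝ} :
    IsEigenvector A x a ↔ (∀ r, ∑ w, A r w * a w = x * a r) ∧ a ≠ 0 := by
  rw [IsEigenvector, Module.End.hasEigenvector_iff, Module.End.mem_eigenspace_iff,
    Matrix.toLin'_apply, funext_iff]
  rfl

/-- A family of fewer coordinates than the multiplicity vanishes at some eigenvector. -/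
theorem exists_isEigenvector_of_card_lt {A : Matrix V V ℝ} {x : ℝ} {T : Finset V}
    (hT : T.card < multiplicity A x) :
    ∃ a, IsEigenvector A x a ∧ ∀ w ∈ T, a w = 0 := by
  let f : Module.End.eigenspace (Matrix.toLin' A) x →ₗ[ℝ] (T → ℝ) :=
    (LinearMap.funLeft ℝ ℝ (Subtype.val : T → V)) ∘ₗ Submodule.subtype _
  have hf : LinearMap.ker f ≠ ⊥ := by
    refine LinearMap.ker_ne_bot_of_finrank_lt ?_
    simpa [multiplicity] using hT
  obtain ⟨a, ha, ha0⟩ := Submodule.exists_mem_ne_zero_of_ne_bot hf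
  refine ⟨a, ⟨a.2, fun h => ha0 (Subtype.ext h)⟩, fun w hw => ?_⟩
  exact congrFun (LinearMap.mem_ker.1 ha) ⟨w, hw⟩

open Classical in
theorem componentVector_eq_adjugate {A : Matrix V V ℝ} (hA : IsAcyclicSymm A) {x : ℝ} {T : Set V}
    {u : V} (hu : u ∈ componentSet A T u) (v : componentSet A T u) :
    componentVector A x T u v =
      (x • (1 : Matrix (componentSet A T u) (componentSet A T u) ℝ) -
        component A T u).adjugate ⟨u, hu⟩ v := by
  rw [componentVector, dif_pos v.2]
  exact pathVector_eq_adjugate (isAcyclicSymm_principal hA _) x _ _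

theorem smul_one_sub_mulVec (B : Matrix V V ℝ) (x : ℝ) (z : V → ℝ) (r : V) :
    ((x • (1 : Matrix V V ℝ) - B) *ᵥ z) r = x * z r - ∑ w, B r w * z w := by
  rw [Matrix.sub_mulVec, Matrix.smul_mulVec, Matrix.one_mulVec]
  rfl

/-- The entry is a determinant with row `u` made an identity row. A null vector vanishes at `u`, and
its extension by zero contradicts the star set property. -/
theorem componentVector_self_ne_zero {A : Matrix V V ℝ} (hA : IsAcyclicSymm A) {x : ℝ}
    {U : Finset V} (hU : IsStarSet A x U) {u : V} (huU : u ∈ U) :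
    componentVector A x ((U : Set V) \ {u}) u u ≠ 0 := by
  classical
  set T : Set V := (U : Set V) \ {u} with hTdef
  have huT : u ∈ Tᶜ := by simp [hTdef]
  have hu : u ∈ componentSet A T u := ⟨huT, huT, .refl _⟩
  rw [componentVector_eq_adjugate hA hu ⟨u, hu⟩, Matrix.adjugate_apply]
  intro hdet
  obtain ⟨z, hz0, hz⟩ := Matrix.exists_mulVec_eq_zero_iff.2 hdet
  have hzu : z ⟨u, hu⟩ = 0 := by
    simpa [Matrix.mulVec, Matrix.updateRow_self] using congrFun hz ⟨u, hu⟩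
  let y : V → ℝ := fun w => if h : w ∈ componentSet A T u then z ⟨w, h⟩ else 0
  have hyC : ∀ w : componentSet A T u, y w = z w := fun w => dif_pos w.2
  have hyn : ∀ w ∉ componentSet A T u, y w = 0 := fun w h => dif_neg h
  have hyT : ∀ w ∈ T, y w = 0 := fun w hw => hyn w fun h => h.2.1 hw
  have hy : y = 0 := by
    refine eq_zero_of_isStarSet hU (fun w hw => ?_) fun r hr => ?_
    · by_cases hwu : w = u
      · subst hwu
        exact (hyC ⟨w, hu⟩).trans hzu
      · exact hyT w ⟨hw, hwu⟩
    · by_cases hrC : r ∈ componentSet A T u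
      · have hru : (⟨r, hrC⟩ : componentSet A T u) ≠ ⟨u, hu⟩ := fun h =>
          hr ((Subtype.mk.inj h).symm ▸ huU)
        have h := congrFun hz ⟨r, hrC⟩
        rw [Matrix.mulVec, Matrix.updateRow_ne hru] at h
        have h' := (smul_one_sub_mulVec (component A T u) x z ⟨r, hrC⟩).symm.trans h
        rw [← sum_component hyT ⟨r, hrC⟩, hyC ⟨r, hrC⟩]
        simp only [hyC]
        exact (sub_eq_zero.1 h').symm
      · rw [hyn r hrC, mul_zero]
        exact sum_eq_zero_of_notMem_componentSet hA.1 hyn (fun h => hr h.1) hrC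
  exact hz0 (funext fun w => by rw [← hyC, hy]; rfl)

theorem isEigenvector_componentVector {A : Matrix V V ℝ} (hA : IsAcyclicSymm A) {x : ℝ}
    {U : Finset V} (hU : IsStarSet A x U) {u : V} (huU : u ∈ U) :
    IsEigenvector A x (componentVector A x ((U : Set V) \ {u}) u) := by
  classical
  have hself := componentVector_self_ne_zero hA hU huU
  obtain ⟨a, ha, haT⟩ := exists_isEigenvector_of_card_lt (A := A) (x := x) (T := U.erase u)
    (by rw [← hU.1]; exact Finset.card_erase_lt_of_mem huU)
  obtain ⟨ha, ha0⟩ := isEigenvector_iff.1 ha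
  have hau : a u ≠ 0 := fun h => ha0 <| eq_zero_of_isStarSet hU (fun w hw => by
    by_cases hwu : w = u
    · rw [hwu, h]
    · exact haT w (Finset.mem_erase.2 ⟨hwu, hw⟩)) fun r _ => ha r
  set T : Set V := (U : Set V) \ {u} with hTdef
  have huT : u ∈ Tᶜ := by simp [hTdef]
  have hu : u ∈ componentSet A T u := ⟨huT, huT, .refl _⟩
  replace haT : ∀ w ∈ T, a w = 0 := fun w hw => haT w (Finset.mem_erase.2 ⟨hw.2, hw.1⟩)
  set b := componentVector A x T u with hb
  have hbn : ∀ w ∉ componentSet A T u, b w = 0 := fun w h => componentVector_of_notMem h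
  have hbT : ∀ w ∈ T, b w = 0 := fun w hw => hbn w fun h => h.2.1 hw
  have hdet : (x • (1 : Matrix (componentSet A T u) (componentSet A T u) ℝ) -
      component A T u).det = 0 := by
    refine Matrix.exists_mulVec_eq_zero_iff.1
      ⟨fun w => a w, fun h => hau (congrFun h ⟨u, hu⟩), funext fun r => ?_⟩
    rw [smul_one_sub_mulVec, sum_component haT, ha, sub_self]
    rfl
  -- Rows in `T` are out of direct reach: they may meet several components.
  have hbrow : ∀ r ∉ U, ∑ w, A r w * b w = x * b r := by
    intro r hr
    by_cases hrC : r ∈ componentSet A T u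
    · set M := x • (1 : Matrix (componentSet A T u) (componentSet A T u) ℝ) - component A T u
        with hM
      have hsymm : M.IsSymm :=
        ((Matrix.isSymm_one (n := componentSet A T u) (α := ℝ)).smul x).sub
          (isAcyclicSymm_principal hA _).1
      have h0 : M *ᵥ (fun w => b w) = 0 := by
        have hcol : (fun w : componentSet A T u => b w) = fun w => M.adjugate w ⟨u, hu⟩ := by
          funext w
          rw [hb, componentVector_eq_adjugate hA hu w, ← hM]
          have h := congrFun (congrFun (Matrix.adjugate_transpose M) w) ⟨u, hu⟩
          rwa [hsymm.eq] at h
        funext r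
        have h := congrFun (congrFun (Matrix.mul_adjugate M) r) ⟨u, hu⟩
        rw [hdet, zero_smul] at h
        rw [hcol]
        exact h
      have h := congrFun h0 ⟨r, hrC⟩
      rw [smul_one_sub_mulVec, sum_component hbT] at h
      exact (sub_eq_zero.1 h).symm
    · rw [hbn r hrC, mul_zero]
      exact sum_eq_zero_of_notMem_componentSet hA.1 hbn (fun h => hr h.1) hrC
  -- This combination is chosen to vanish at `u`, hence on all of `U`; comparison with `a` then
  -- yields the rows in `U`.
  have hprop : a u • b - b u • a = 0 := by
    refine eq_zero_of_isStarSet hU (fun w hw => ?_) fun r hr => ?_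
    · by_cases hwu : w = u
      · subst hwu
        simp [mul_comm]
      · have hwT : w ∈ T := ⟨hw, hwu⟩
        simp [hbT w hwT, haT w hwT]
    · simp only [Pi.sub_apply, Pi.smul_apply, smul_eq_mul, mul_sub, Finset.sum_sub_distrib,
        mul_left_comm (A r _), ← Finset.mul_sum, hbrow r hr, ha r]
      ring
  have hba : b = (b u / a u) • a := by
    funext w
    have h := congrFun hprop w
    simp only [Pi.sub_apply, Pi.smul_apply, smul_eq_mul, Pi.zero_apply] at h ⊢
    field_simp
    linarith
  refine isEigenvector_iff.2 ⟨fun r => ?_, fun h => hself (congrFun h u)⟩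
  rw [hba]
  simp only [Pi.smul_apply, smul_eq_mul, mul_left_comm (A r _), ← Finset.mul_sum, ha r]
  ring

end StarSet

end AcyclicMatrix

theorem theorem3p5 (n : ℕ) (A : Matrix (Fin n) (Fin n) ℝ) (hA : AcyclicMatrix.IsAcyclicSymm A)
    (lam : ℝ) (hlam : AcyclicMatrix.IsEigenvalue A lam)
    (k : ℕ) (hk : AcyclicMatrix.multiplicity A lam = k)
    (U : Finset (Fin n)) (hU : AcyclicMatrix.IsStarSet A lam U)
    (u : Fin k → Fin n) (hu : Set.range u = (U : Set (Fin n))) :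
    (∀ i : Fin k, AcyclicMatrix.IsEigenvector A lam
      (AcyclicMatrix.componentVector A lam ((U : Set (Fin n)) \ {u i}) (u i))) ∧
    LinearIndependent ℝ (fun i : Fin k =>
      AcyclicMatrix.componentVector A lam ((U : Set (Fin n)) \ {u i}) (u i)) := by
  have huU : ∀ i, u i ∈ U := fun i => by
    rw [← Finset.mem_coe, ← hu]
    exact Set.mem_range_self i
  refine ⟨fun i => AcyclicMatrix.isEigenvector_componentVector hA hU (huU i), ?_⟩
  have himage : Finset.univ.image u = U := by
    rw [← Finset.coe_inj, ← hu]
    simp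
  have hinj : Function.Injective u := by
    rw [← Set.injOn_univ, ← Finset.coe_univ, ← Finset.card_image_iff, himage, hU.1, hk]
    simp
  rw [Fintype.linearIndependent_iff]
  intro g hg i
  have h := congrFun hg (u i)
  -- At `u i` every other vector vanishes, since `u i` is among its deleted vertices.
  rw [Finset.sum_apply, Finset.sum_eq_single i] at h
  · exact (mul_eq_zero.1 h).resolve_right
      (AcyclicMatrix.componentVector_self_ne_zero hA hU (huU i))
  · intro j _ hji
    have hmem : u i ∈ (U : Set (Fin n)) \ {u j} := ⟨huU i, fun h => hji (hinj h).symm⟩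
    exact mul_eq_zero_of_right _
      (AcyclicMatrix.componentVector_of_notMem fun h => h.2.1 hmem)
  · simp
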